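/- **Setting.** Let $\mathbb N=\{1,2,\dots\}$, $p\ge 0$, $\varepsilon>0$, $\kappa_i^2=i^{2p}$, $\sigma_i^2=\varepsilon^2\kappa_i^2$, $\Sigma(I)=\sum_{i\le I}\sigma_i^2$. For $\theta\in\ell_2$ one observes $X=(X_i)_{i\in\mathbb N}\sim \mathrm P_\theta=\bigotimes_i N(\theta_i,\sigma_i^2)$; $\mathrm E_\theta$ is the expectation under $\mathrm P_\theta$ and $\|\cdot\|$ the $\ell_2$-norm (equal to $+\infty$ outside $\ell_2$). A data-dependent center is a measurable map $\hat\theta=\hat\theta(X)$, $\hat\theta:\mathbb R^{\mathbb N}\to\mathbb R^{\mathbb N}$ (for example with values in $\ell_2$). For $K,\alpha>0$ put $\lambda_I=(e^\alpha-1)e^{-\alpha I}$, $X_i(I)=X_i 1\{i\le I\}$, $\tau_i^2(I)=K\sigma_i^2 1\{i\le I\}$, let $\varphi(\cdot,\mu,v)$ be the $N(\mu,v)$-density and $N(\mu,0)$ the Dirac mass at $\mu$. Define the data-dependent measure $$\mathrm P(\cdot|X)=\sum_{I\in\mathbb N}\mathrm P_I(\cdot|X)\,\mathrm P(\mathcal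 I=I|X),\qquad \mathrm P_I(\cdot|X)=\bigotimes_i N\Big(X_i(I),\tfrac{K}{K+1}\sigma_i^2 1\{i\le I\}\Big),$$ $$\mathrm P(\mathcal I=I|X)=\lim_{n\to\infty}\frac{\lambda_I\prod_{i=1}^n\varphi(X_i,X_i(I),\tau_i^2(I)+\sigma_i^2)}{\sum_J\lambda_J\prod_{i=1}^n\varphi(X_i,X_i(J),\tau_i^2(J)+\sigma_i^2)}$$ (the limit exists for every $X$). For $\theta\in\ell_2$ let the oracle rate $r(\theta)\ge 0$ be given by $r^2(\theta)=\min_{I\in\mathbb N}\big(\Sigma(I)+\sum_{i>I}\theta_i^2\big)$. A surrogate oracle of $\theta$ is any minimizer $\bar I_o=\bar I_o(\theta)\in\mathbb N$ of $I\mapsto I\varepsilon^2+\sum_{i>I}\theta_i^2/\kappa_i^2$. For $\tau>0$ the excessive bias restriction set is $$\Theta_{eb}(\tau)=\Big\{\theta\in\ell_2:\ \sum_{i>\bar I_o}\theta_i^2\le\tau\,\Sigma(\bar I_o)\ \text{ for some surrogate oracle } \bar I_o \text{ of } \theta\Big\}.$$ Let $a(K)=\frac14-\frac12\log\frac{K+1}{2}$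 and, when $\alpha<a(K)$, $$\delta_{sb}=1\wedge\bigg(\sqrt{\tfrac{K(2p+1)}{K+1}}\Big(\tfrac{a(K)-\alpha}{4e\,a(K)}\Big)^{p+1/2}\bigg),\qquad \delta_{eb}=(1+\tau)^{-1/2}\delta_{sb}.$$ **Corollary (lower bound under EBR).** Let $K,\alpha>0$ with $\alpha<a(K)$. There is a constant $C_{sb}=C_{sb}(K,\alpha)>0$ such that for all $p\ge 0$, all $\varepsilon>0$ and every data-dependent center $\hat\theta$ the following hold. (a) (Small ball bound, which identifies $C_{sb}$.) For every $\theta_0\in\ell_2$, every surrogate oracle $\bar I_o$ of $\theta_0$ and every $\delta\in(0,\delta_{sb}]$, $$\mathrm E_{\theta_0}\mathrm P\big(\|\theta-\hat\theta\|\le\delta\,\Sigma^{1/2}(\bar I_o)\,\big|\,X\big)\le C_{sb}\,\delta\,[\log(1/\delta)]^{p+1/2}.$$ (b) For every $\tau>0$ and every $\delta\in(0,\delta_{eb}]$, $$\sup_{\theta_0\in\Theta_{eb}(\tau)}\mathrm E_{\theta_0}\mathrm P\big(\|\theta-\hat\theta\|\le\delta\,r(\theta_0)\,\big|\,X\big)\le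 C_{sb}\sqrt{1+\tau}\;\delta\,[\log(1/\delta)]^{p+1/2}.$$ -/

import Mathlib

open MeasureTheory ProbabilityTheory Filter Topology
open scoped ENNReal NNReal

namespace InverseNoise

noncomputable section

/-! Sequences are indexed by `ℕ+ = {1, 2, …}`; the data `X` and the parameter `θ` live in
`ℕ+ → ℝ`. -/

/-- `κ_i² = i^{2p}` (mildly ill-posed case). -/
def kappaSq (p : ℝ) (i : ℕ+) : ℝ := (i : ℝ) ^ (2 * p)

/-- Noise variance `σ_i² = ε² κ_i²`. -/
def noiseVar (p ε : ℝ) (i : ℕ+) : ℝ := ε ^ 2 * kappaSq p i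

/-- `Σ(I) = ∑_{i ≤ I} σ_i²`. -/
def cumVar (p ε : ℝ) (I : ℕ+) : ℝ := ∑ i ∈ Finset.Icc 1 I, noiseVar p ε i

/-- The law `P_θ = ⨂_i N(θ_i, σ_i²)` of the data. -/
def dataLaw (p ε : ℝ) (θ : ℕ+ → ℝ) : Measure (ℕ+ → ℝ) :=
  Measure.infinitePi fun i => gaussianReal (θ i) (noiseVar p ε i).toNNReal

/-- `X(I) = (X_i 1{i ≤ I})_i`. -/
def truncate (I : ℕ+) (X : ℕ+ → ℝ) : ℕ+ → ℝ := fun i => if i ≤ I then X i else 0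

/-- Prior variances `τ_i²(I) = K σ_i² 1{i ≤ I}`. -/
def priorVar (K p ε : ℝ) (I i : ℕ+) : ℝ := if i ≤ I then K * noiseVar p ε i else 0

/-- `λ_I = (e^α - 1) e^{-α I}`, a probability distribution on `{1, 2, …}` for `α > 0`. -/
def priorWeight (α : ℝ) (I : ℕ+) : ℝ := (Real.exp α - 1) * Real.exp (-α * (I : ℝ))

/-- `λ_I ∏_{i ≤ n} φ(X_i, X_i(I), τ_i²(I) + σ_i²)`, where `φ(·, μ, v)` is the density of
`N(μ, v)`. -/
def evidence (K α p ε : ℝ) (n I : ℕ+) (X : ℕ+ → ℝ) : ℝ≥0∞ :=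
  ENNReal.ofReal (priorWeight α I) *
    ∏ i ∈ Finset.Icc 1 n,
      gaussianPDF (truncate I X i) (priorVar K p ε I i + noiseVar p ε i).toNNReal (X i)

/-- `P_n(𝓘 = I | X)`, computed from the first `n` coordinates. -/
def mixWeightN (K α p ε : ℝ) (n I : ℕ+) (X : ℕ+ → ℝ) : ℝ≥0∞ :=
  evidence K α p ε n I X / ∑' J : ℕ+, evidence K α p ε n J X

/-- `P(𝓘 = I | X) = lim_n P_n(𝓘 = I | X)`. The limit exists for every `X`, see
`tendsto_mixWeightN` below. -/
def mixWeight (K α p ε : ℝ) (I : ℕ+) (X : ℕ+ → ℝ) : ℝ≥0∞ :=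
  liminf (fun n : ℕ+ => mixWeightN K α p ε n I X) atTop

/-- `P_I(· | X) = ⨂_i N(X_i(I), L σ_i² 1{i ≤ I})` with `L = K / (K + 1)`; a Gaussian with
variance `0` is a Dirac mass. -/
def component (K p ε : ℝ) (I : ℕ+) (X : ℕ+ → ℝ) : Measure (ℕ+ → ℝ) :=
  Measure.infinitePi fun i =>
    gaussianReal (truncate I X i) (if i ≤ I then K / (K + 1) * noiseVar p ε i else 0).toNNReal

/-- The data dependent measure `P(· | X) = ∑_I P_I(· | X) P(𝓘 = I | X)`. -/
def ddm (K α p ε : ℝ) (X : ℕ+ → ℝ) : Measure (ℕ+ → ℝ) :=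
  Measure.sum fun I : ℕ+ => mixWeight K α p ε I X • component K p ε I X

/-- The `ℓ₂` ball `{θ : ‖θ - c‖ ≤ r}` (for `r ≥ 0`); the `ℓ₂` norm of a sequence that is not
square summable is `∞`. -/
def l2Ball (c : ℕ+ → ℝ) (r : ℝ) : Set (ℕ+ → ℝ) :=
  {θ | (∑' i, ENNReal.ofReal ((θ i - c i) ^ 2)) ^ (1 / 2 : ℝ) ≤ ENNReal.ofReal r}

/-- `E_{θ₀} P(‖θ - θ̂‖ ≤ r | X)`, where `X ∼ P_{θ₀}` and `θ̂ = θ̂(X)`. -/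
def expBallMass (K α p ε : ℝ) (θhat : (ℕ+ → ℝ) → (ℕ+ → ℝ)) (θ₀ : ℕ+ → ℝ) (r : ℝ) : ℝ≥0∞ :=
  ∫⁻ X, ddm K α p ε X (l2Ball (θhat X) r) ∂(dataLaw p ε θ₀)

/-- The parameter space `ℓ₂`. -/
def ell2 : Set (ℕ+ → ℝ) := {θ | Summable fun i => θ i ^ 2}

/-- `r²(I, θ) = ∑_{i ≤ I} σ_i² + ∑_{i > I} θ_i²`. -/
def localRateSq (p ε : ℝ) (I : ℕ+) (θ : ℕ+ → ℝ) : ℝ :=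
  cumVar p ε I + ∑' i : Set.Ioi I, θ i ^ 2

/-- The oracle rate `r(θ) = (min_I r²(I, θ))^{1/2}`. -/
def oracleRate (p ε : ℝ) (θ : ℕ+ → ℝ) : ℝ := Real.sqrt (⨅ I : ℕ+, localRateSq p ε I θ)

/-- `R²(I, θ) = I ε² + ∑_{i > I} θ_i² / κ_i²`. -/
def surrogateRateSq (p ε : ℝ) (I : ℕ+) (θ : ℕ+ → ℝ) : ℝ :=
  (I : ℝ) * ε ^ 2 + ∑' i : Set.Ioi I, θ i ^ 2 / kappaSq p i

/-- `I` is a surrogate oracle of `θ`, i.e. a minimizer of `R²(·, θ)`. It need not be unique. -/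
def IsSurrogateOracle (p ε : ℝ) (θ : ℕ+ → ℝ) (I : ℕ+) : Prop :=
  ∀ J : ℕ+, surrogateRateSq p ε I θ ≤ surrogateRateSq p ε J θ

/-- The excessive bias restriction set `Θ_eb(τ)`. If `R²(·, θ)` has several minimizers, the
condition is asked at one of them only, so that this set contains the one given by any fixed
rule for breaking ties. -/
def excessBiasSet (p ε τ : ℝ) : Set (ℕ+ → ℝ) :=
  {θ | θ ∈ ell2 ∧ ∃ I : ℕ+, IsSurrogateOracle p ε θ I ∧
    ∑' i : Set.Ioi I, θ i ^ 2 ≤ τ * cumVar p ε I}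

/-- `a(K) = 1/4 - (1/2) log((K + 1) / 2)`. -/
def aConst (K : ℝ) : ℝ := 1 / 4 - 1 / 2 * Real.log ((K + 1) / 2)

/-- `δ_sb`. -/
def deltaSB (K α p : ℝ) : ℝ :=
  min 1 (Real.sqrt (K * (2 * p + 1) / (K + 1)) *
    ((aConst K - α) / (4 * Real.exp 1 * aConst K)) ^ (p + 1 / 2))

/-- `δ_eb = (1 + τ)^{-1/2} δ_sb`. -/
def deltaEB (K α p τ : ℝ) : ℝ := (1 + τ) ^ (-(1 / 2) : ℝ) * deltaSB K α p

lemma noiseVar_pos {p ε : ℝ} (hε : 0 < ε) (i : ℕ+) : 0 < noiseVar p ε i := by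
  have : (0 : ℝ) < (i : ℝ) := by exact_mod_cast i.pos
  unfold noiseVar kappaSq
  positivity

/-- `P_n(𝓘 = I | X)` converges as `n → ∞`, for every `X`. -/
theorem tendsto_mixWeightN {K α p ε : ℝ} (hK : 0 < K) (hα : 0 < α) (hε : 0 < ε)
    (I : ℕ+) (X : ℕ+ → ℝ) :
    Tendsto (fun n : ℕ+ => mixWeightN K α p ε n I X) atTop (𝓝 (mixWeight K α p ε I X)) := by
  suffices h : ∃ l, Tendsto (fun n : ℕ+ => mixWeightN K α p ε n I X) atTop (𝓝 l) by
    obtain ⟨l, hl⟩ := h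
    rw [mixWeight, hl.liminf_eq]
    exact hl
  let A : ℕ+ → ℝ≥0∞ := fun i =>
    gaussianPDF (X i) (K * noiseVar p ε i + noiseVar p ε i).toNNReal (X i)
  let B : ℕ+ → ℝ≥0∞ := fun i => gaussianPDF 0 (noiseVar p ε i).toNNReal (X i)
  have hB0 : ∀ i, B i ≠ 0 := fun i => (gaussianPDF_pos _
    (by simpa using (noiseVar_pos hε i)) _).ne'
  have hBt : ∀ i, B i ≠ ∞ := fun i => ENNReal.ofReal_ne_top
  have hAt : ∀ i, A i ≠ ∞ := fun i => ENNReal.ofReal_ne_top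
  have hA0 : ∀ i, A i ≠ 0 := fun i => (gaussianPDF_pos _
    (by have := noiseVar_pos (p := p) hε i; simp; positivity) _).ne'
  let w : ℕ+ → ℝ≥0∞ := fun J => ENNReal.ofReal (priorWeight α J)
  let v : ℕ+ → ℝ≥0∞ := fun m => ∏ i ∈ Finset.Icc 1 m, (A i / B i)
  let c : ℕ+ → ℝ≥0∞ := fun n => ∏ i ∈ Finset.Icc 1 n, B i
  have hc0 : ∀ n, c n ≠ 0 := fun n => Finset.prod_ne_zero_iff.2 fun i _ => hB0 i
  have hct : ∀ n, c n ≠ ∞ := fun n => ENNReal.prod_ne_top fun i _ => hBt i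
  have hw0 : ∀ J, w J ≠ 0 := fun J => by
    have : 0 < Real.exp α - 1 := by simpa using hα
    simp only [w, priorWeight, ne_eq, ENNReal.ofReal_eq_zero, not_le]
    positivity
  have hv0 : ∀ m, v m ≠ 0 := fun m => Finset.prod_ne_zero_iff.2 fun i _ =>
    (ENNReal.div_pos (hA0 i) (hBt i)).ne'
  have hvt : ∀ m, v m ≠ ∞ := fun m => ENNReal.prod_ne_top fun i _ =>
    ENNReal.div_ne_top (hAt i) (hB0 i)
  have hev : ∀ n J, evidence K α p ε n J X = c n * (w J * v (min J n)) := by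
    intro n J
    have h1 : v (min J n) = ∏ i ∈ Finset.Icc 1 n, (if i ≤ J then A i / B i else 1) := by
      rw [← Finset.prod_filter]
      refine Finset.prod_congr ?_ fun _ _ => rfl
      ext i
      simp only [Finset.mem_Icc, Finset.mem_filter, le_min_iff]
      tauto
    rw [h1, mul_left_comm, ← Finset.prod_mul_distrib, evidence]
    congr 1
    refine Finset.prod_congr rfl fun i _ => ?_
    by_cases h : i ≤ J
    · simp only [truncate, priorVar, h, if_true]
      exact (ENNReal.mul_div_cancel (hB0 i) (hBt i)).symm
    · simp [truncate, priorVar, h, B]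
  let D : ℕ+ → ℝ≥0∞ := fun n => ∑' J, w J * v (min J n)
  have hmix : ∀ n, mixWeightN K α p ε n I X = w I * v (min I n) / D n := by
    intro n
    simp only [mixWeightN, hev, ENNReal.tsum_mul_left, D]
    exact ENNReal.mul_div_mul_left _ _ (hc0 n) (hct n)
  let S : ℝ≥0∞ := ∑' J, w J * v J
  have hlow : Tendsto (fun n : ℕ+ => ∑ J ∈ Finset.Icc 1 n, w J * v J) atTop (𝓝 S) :=
    (ENNReal.summable.hasSum).comp (tendsto_atTop_finset_of_monotone
      (fun a b h => Finset.Icc_subset_Icc_right h) fun x => ⟨x, by simp⟩)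
  have hlowle : ∀ n, ∑ J ∈ Finset.Icc 1 n, w J * v J ≤ D n := by
    intro n
    refine le_trans (le_of_eq ?_) (ENNReal.sum_le_tsum (Finset.Icc 1 n))
    refine Finset.sum_congr rfl fun J hJ => ?_
    rw [min_eq_left (Finset.mem_Icc.1 hJ).2]
  have hD : Tendsto D atTop (𝓝 S) := by
    by_cases hS : S = ∞
    · rw [hS] at hlow ⊢
      exact tendsto_nhds_top_mono hlow (Eventually.of_forall hlowle)
    · let q : ℝ≥0∞ := ∑' k : ℕ+, ENNReal.ofReal (Real.exp (-α * (k : ℝ)))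
      have hq : q ≠ ∞ := by
        have h1 : Summable fun k : ℕ+ => Real.exp (-α * (k : ℝ)) := by
          have h2 : Summable fun k : ℕ => Real.exp ((k : ℝ) * (-α)) :=
            Real.summable_exp_nat_mul_iff.2 (by linarith)
          have h3 := h2.comp_injective PNat.coe_injective
          refine h3.congr fun k => ?_
          simp [mul_comm]
        exact h1.tsum_ofReal_ne_top
      have hup : ∀ n, D n ≤ S + w n * v n * q := by
        intro n
        have h1 : ∑' J : ℕ+, (if n < J then w J * v n else 0) = w n * v n * q := by
          have hinj : Function.Injective fun k : ℕ+ => n + k := fun a b h => add_left_cancel h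
          rw [← hinj.tsum_eq]
          · rw [← ENNReal.tsum_mul_left]
            refine tsum_congr fun k => ?_
            rw [if_pos (PNat.lt_add_right n k), mul_right_comm]
            congr 1
            have : 0 < Real.exp α - 1 := by simpa using hα
            simp only [w, priorWeight]
            rw [← ENNReal.ofReal_mul (by positivity), mul_assoc, ← Real.exp_add]
            congr 3
            push_cast
            ring
          · intro J hJ
            have hJ' : n < J := by
              by_contra h
              simp [h] at hJ
            exact ⟨J - n, PNat.add_sub_of_lt hJ'⟩
        rw [← h1, ← ENNReal.tsum_add]
        refine ENNReal.tsum_le_tsum fun J => ?_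
        by_cases h : n < J
        · rw [if_pos h, min_eq_right h.le]
          exact le_add_self
        · rw [min_eq_left (not_lt.1 h)]
          exact le_self_add
      have h0 : Tendsto (fun n => w n * v n) atTop (𝓝 0) := by
        have h1 := ENNReal.tendsto_cofinite_zero_of_tsum_ne_top hS
        refine h1.mono_left ?_
        exact le_cofinite_iff_eventually_ne.2 fun x =>
          (eventually_gt_atTop x).mono fun y hy => ne_of_gt hy
      have hup' : Tendsto (fun n => S + w n * v n * q) atTop (𝓝 S) := by
        have h2 := ENNReal.Tendsto.mul_const h0 (Or.inr hq) (b := q)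
        simpa using h2.const_add S
      exact tendsto_of_tendsto_of_tendsto_of_le_of_le hlow hup' hlowle hup
  refine ⟨w I * v I / S, ?_⟩
  have hS0 : S ≠ 0 := by
    intro h
    have := ENNReal.tsum_eq_zero.1 h I
    simp [hw0, hv0] at this
  have hlim : Tendsto (fun n => w I * v I / D n) atTop (𝓝 (w I * v I / S)) :=
    ENNReal.Tendsto.const_div hD (Or.inr (ENNReal.mul_ne_top ENNReal.ofReal_ne_top (hvt I)))
  refine hlim.congr' ?_
  filter_upwards [eventually_ge_atTop I] with n hn
  rw [hmix, min_eq_left hn]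

end

end InverseNoise

open InverseNoise

namespace InverseNoise

/-! Fix a surrogate oracle `N`, write `s = p + 1/2`, `b = a(K) - α`, `l = log (1/δ)`, and split the
mixture over `I` at `2 * I < N`.

Models with `2 * I < N` are unlikely under `P_θ`. Their weight is at most the evidence ratio against
`N`, a product over `(I, N]` whose expectation is explicit. Minimality of `N` forces `∑ θ_i²/σ_i² ≥
N - I` there, so the expectation is at most `exp (-b (N - I))` (`lintegral_evidenceRatio_le`).

Each component spreads its mass: by a Chernoff bound using `J ≤ I` coordinates, a ball of radius `δ
Σ(N)^{1/2}` has mass at most `(δ (eN/J)^s / √(K/(K+1)))^J`, whatever its center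
(`component_l2Ball_le`). For `2 * I ≥ N` take `J = min I N`, so that `N/J ≤ 2`. For small `I` take
`J = 1`; the resulting `N^s` is absorbed by the exponential, at the cost of `l^s`.

The constant must not depend on `p`. If `l` exceeds a fixed multiple of `s`, the factors `(2e)^s`
and `(s/b)^s` are below `l^s` up to fixed bases. Otherwise `δ l^s` is bounded below uniformly in
`p`, and the trivial bound `1` suffices.

Under the bias restriction `r(θ) ≤ √(1+τ) Σ(N)^{1/2}`, so (b) is (a) at `√(1+τ) δ`. -/

/-! ### Product and Gaussian integrals. -/

theorem lintegral_infinitePi_prod {ι : Type*} (μ : ι → Measure ℝ)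
    [∀ i, IsProbabilityMeasure (μ i)] (F : Finset ι) (f : ι → ℝ → ℝ≥0∞)
    (hf : ∀ i, Measurable (f i)) :
    ∫⁻ x, ∏ i ∈ F, f i (x i) ∂(Measure.infinitePi μ) = ∏ i ∈ F, ∫⁻ y, f i y ∂(μ i) := by
  have hind : iIndepFun (fun i (x : ι → ℝ) => f i (x i)) (Measure.infinitePi μ) :=
    iIndepFun_infinitePi (P := μ) (X := f) hf
  rw [lintegral_prod_eq_prod_lintegral_of_indepFun F _ hind
    fun i => (hf i).comp (measurable_pi_apply i)]
  refine Finset.prod_congr rfl fun i _ => ?_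
  rw [← Measure.infinitePi_map_eval μ i, lintegral_map (hf i) (measurable_pi_apply i)]

theorem lintegral_exp_neg_mul_sub_sq {b : ℝ} (hb : 0 < b) (c : ℝ) :
    ∫⁻ x : ℝ, ENNReal.ofReal (Real.exp (-b * (x - c) ^ 2)) =
      ENNReal.ofReal (Real.sqrt (Real.pi / b)) := by
  rw [lintegral_sub_right_eq_self (fun x => ENNReal.ofReal (Real.exp (-b * x ^ 2))) c,
    ← ofReal_integral_eq_lintegral_ofReal (integrable_exp_neg_mul_sq hb)
      (ae_of_all _ fun x => (Real.exp_pos _).le), integral_gaussian]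

theorem lintegral_gaussianReal {v : ℝ≥0} (hv : v ≠ 0) (m : ℝ) {f : ℝ → ℝ≥0∞}
    (hf : Measurable f) :
    ∫⁻ x, f x ∂(gaussianReal m v) = ∫⁻ x, gaussianPDF m v x * f x := by
  rw [gaussianReal_of_var_ne_zero m hv,
    lintegral_withDensity_eq_lintegral_mul _ (measurable_gaussianPDF m v) hf]
  rfl

/-- Bounding the density by its maximum makes the estimate uniform in `m` and `c`; hence the center
may depend on the data arbitrarily. -/
theorem lintegral_gaussianReal_exp_sub_sq_le {v t : ℝ} (hv : 0 < v) (ht : 0 < t) (m c : ℝ) :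
    ∫⁻ x, ENNReal.ofReal (Real.exp (-t * (x - c) ^ 2)) ∂(gaussianReal m v.toNNReal) ≤
      ENNReal.ofReal (Real.sqrt (2 * t * v))⁻¹ := by
  have hv' : v.toNNReal ≠ 0 := by simpa using hv
  rw [lintegral_gaussianReal hv' m (by fun_prop)]
  calc ∫⁻ x, gaussianPDF m v.toNNReal x * ENNReal.ofReal (Real.exp (-t * (x - c) ^ 2))
      ≤ ∫⁻ x, ENNReal.ofReal (Real.sqrt (2 * Real.pi * v))⁻¹ *
          ENNReal.ofReal (Real.exp (-t * (x - c) ^ 2)) := by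
        refine lintegral_mono fun x => ?_
        gcongr
        refine ENNReal.ofReal_le_ofReal ?_
        rw [gaussianPDFReal, Real.coe_toNNReal v hv.le]
        refine mul_le_of_le_one_right (by positivity) (Real.exp_le_one_iff.2 ?_)
        rw [neg_div]
        exact neg_nonpos.2 (by positivity)
    _ = ENNReal.ofReal (Real.sqrt (2 * t * v))⁻¹ := by
        rw [lintegral_const_mul _ (by fun_prop), lintegral_exp_neg_mul_sub_sq ht,
          ← ENNReal.ofReal_mul (by positivity), ← Real.sqrt_inv, ← Real.sqrt_inv,
          ← Real.sqrt_mul (by positivity)]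
        congr 2
        have := Real.pi_pos
        field_simp

theorem lintegral_gaussianReal_exp_neg_sq {v : ℝ} (hv : 0 < v) (m : ℝ) :
    ∫⁻ x, ENNReal.ofReal (Real.exp (-(x ^ 2 / (2 * v)))) ∂(gaussianReal m v.toNNReal) =
      ENNReal.ofReal (Real.exp (-(1 / 2 * Real.log 2) - m ^ 2 / (4 * v))) := by
  have hv' : v.toNNReal ≠ 0 := by simpa using hv
  rw [lintegral_gaussianReal hv' m (by fun_prop)]
  calc ∫⁻ x, gaussianPDF m v.toNNReal x * ENNReal.ofReal (Real.exp (-(x ^ 2 / (2 * v))))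
      = ∫⁻ x, ENNReal.ofReal ((Real.sqrt (2 * Real.pi * v))⁻¹ * Real.exp (- (m ^ 2 / (4 * v)))) *
          ENNReal.ofReal (Real.exp (-(1 / v) * (x - m / 2) ^ 2)) := by
        refine lintegral_congr fun x => ?_
        -- Completing the square: `(x - m)² + x² = 2 (x - m/2)² + m²/2`.
        have key : Real.exp (-(x - m) ^ 2 / (2 * v)) * Real.exp (-(x ^ 2 / (2 * v))) =
            Real.exp (-(m ^ 2 / (4 * v))) * Real.exp (-(1 / v) * (x - m / 2) ^ 2) := by
          rw [← Real.exp_add, ← Real.exp_add]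
          congr 1
          field_simp
          ring
        rw [gaussianPDF, gaussianPDFReal, Real.coe_toNNReal v hv.le,
          ← ENNReal.ofReal_mul (by positivity), ← ENNReal.ofReal_mul (by positivity),
          mul_assoc _ (Real.exp _) (Real.exp _), key, ← mul_assoc _ (Real.exp _) (Real.exp _)]
    _ = _ := by
        rw [lintegral_const_mul _ (by fun_prop), lintegral_exp_neg_mul_sub_sq (by positivity),
          ← ENNReal.ofReal_mul (by positivity), sub_eq_add_neg, Real.exp_add, mul_right_comm]
        congr 2
        have hl : 1 / 2 * Real.log 2 = Real.log (Real.sqrt 2) := by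
          rw [Real.log_sqrt zero_le_two]
          ring
        rw [hl, Real.exp_neg,
          Real.exp_log (by positivity), ← Real.sqrt_inv, ← Real.sqrt_inv,
          ← Real.sqrt_mul (by positivity)]
        congr 1
        have := Real.pi_pos
        field_simp

/-! ### Factorials, cumulative variances and balls. -/

theorem prod_Icc_pnat {M : Type*} [CommMonoid M] (J : ℕ+) (f : ℕ → M) :
    ∏ i ∈ Finset.Icc (1 : ℕ+) J, f i = ∏ i ∈ Finset.Icc 1 (J : ℕ), f i := by
  refine Finset.prod_bij (fun i _ => (i : ℕ)) (fun i hi => ?_) (fun _ _ _ _ h => PNat.eq h)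
    (fun k hk => ?_) fun _ _ => rfl
  · exact Finset.mem_Icc.2 ⟨i.pos, (Finset.mem_Icc.1 hi).2⟩
  · have := Finset.mem_Icc.1 hk
    exact ⟨⟨k, this.1⟩, Finset.mem_Icc.2 ⟨one_le, this.2⟩, rfl⟩

/-- One term of the exponential series, `J^J / J! ≤ e^J`. -/
theorem pow_div_exp_le_prod_Icc (J : ℕ+) :
    ((J : ℝ) / Real.exp 1) ^ (J : ℕ) ≤ ∏ i ∈ Finset.Icc (1 : ℕ+) J, (i : ℝ) := by
  have h1 := Real.pow_div_factorial_le_exp (x := (J : ℝ)) (by positivity) J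
  rw [prod_Icc_pnat J fun i => (i : ℝ), ← Nat.cast_prod, ← Finset.Ico_add_one_right_eq_Icc,
    Finset.prod_Ico_id_eq_factorial,
    div_pow, ← Real.exp_nat_mul, mul_one]
  rw [div_le_iff₀ (by positivity)] at h1 ⊢
  linarith

theorem cumVar_le {p ε : ℝ} (hp : 0 ≤ p) (N : ℕ+) :
    cumVar p ε N ≤ ε ^ 2 * (N : ℝ) ^ (2 * p + 1) := by
  have h : ∀ i ∈ Finset.Icc (1 : ℕ+) N, noiseVar p ε i ≤ ε ^ 2 * (N : ℝ) ^ (2 * p) := by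
    intro i hi
    unfold noiseVar kappaSq
    have : (i : ℝ) ≤ N := by exact_mod_cast (Finset.mem_Icc.1 hi).2
    gcongr
  refine (Finset.sum_le_card_nsmul _ _ _ h).trans (le_of_eq ?_)
  rw [PNat.card_Icc, nsmul_eq_mul, Real.rpow_add (by simp), Real.rpow_one]
  simp
  ring

theorem cumVar_pos {p ε : ℝ} (hε : 0 < ε) (N : ℕ+) : 0 < cumVar p ε N :=
  Finset.sum_pos (fun i _ => noiseVar_pos hε i) ⟨1, by simp⟩

theorem measurableSet_l2Ball (c : ℕ+ → ℝ) (r : ℝ) : MeasurableSet (l2Ball c r) := by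
  refine measurableSet_le (Measurable.pow_const ?_ _) measurable_const
  exact Measurable.tsum fun i => by fun_prop

theorem sum_sq_le_of_mem_l2Ball {c θ : ℕ+ → ℝ} {r : ℝ} (hr : 0 ≤ r) (h : θ ∈ l2Ball c r)
    (F : Finset ℕ+) : ∑ i ∈ F, (θ i - c i) ^ 2 ≤ r ^ 2 := by
  have h1 : (∑' i, ENNReal.ofReal ((θ i - c i) ^ 2)) ^ (1 / 2 : ℝ) ≤ ENNReal.ofReal r := h
  have h2 := ENNReal.rpow_le_rpow h1 (zero_le_two (α := ℝ))
  rw [← ENNReal.rpow_mul, ENNReal.ofReal_rpow_of_nonneg hr zero_le_two] at h2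
  norm_num at h2
  rw [← ENNReal.ofReal_le_ofReal_iff (by positivity),
    ENNReal.ofReal_sum_of_nonneg fun i _ => by positivity]
  exact (ENNReal.sum_le_tsum F).trans h2

theorem l2Ball_mono (c : ℕ+ → ℝ) {r s : ℝ} (h : r ≤ s) : l2Ball c r ⊆ l2Ball c s :=
  fun _ hθ => le_trans (α := ℝ≥0∞) hθ (ENNReal.ofReal_le_ofReal h)

/-! ### Models well below the surrogate oracle have small expected weight. -/

/-- The likelihood ratio of the model `I` against the model `N`, for `I ≤ N`, in one of the
coordinates in which they differ. -/
noncomputable def coordRatio (K p ε : ℝ) (i : ℕ+) (x : ℝ) : ℝ≥0∞ :=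
  ENNReal.ofReal (Real.exp (1 / 2 * Real.log (K + 1))) *
    ENNReal.ofReal (Real.exp (-(x ^ 2 / (2 * noiseVar p ε i))))

/-- The ratio of the evidences of `I` and `N`, for `I ≤ N`. -/
noncomputable def evidenceRatio (K α p ε : ℝ) (I N : ℕ+) (X : ℕ+ → ℝ) : ℝ≥0∞ :=
  ENNReal.ofReal (Real.exp (α * ((N : ℝ) - I))) *
    ∏ i ∈ Finset.Ioc I N, coordRatio K p ε i (X i)

theorem measurable_coordRatio (K p ε : ℝ) (i : ℕ+) : Measurable (coordRatio K p ε i) := by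
  unfold coordRatio
  fun_prop

theorem measurable_evidenceRatio (K α p ε : ℝ) (I N : ℕ+) :
    Measurable (evidenceRatio K α p ε I N) := by
  refine Measurable.const_mul (Finset.measurable_fun_prod _ fun i _ => ?_) _
  exact (measurable_coordRatio K p ε i).comp (measurable_pi_apply i)

theorem coordRatio_mul_gaussianPDF {K p ε : ℝ} (hK : 0 < K) (hε : 0 < ε) (i : ℕ+) (x : ℝ) :
    coordRatio K p ε i x * gaussianPDF x (K * noiseVar p ε i + noiseVar p ε i).toNNReal x =
      gaussianPDF 0 (noiseVar p ε i).toNNReal x := by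
  have hv := noiseVar_pos (p := p) hε i
  have hl : 1 / 2 * Real.log (K + 1) = Real.log (Real.sqrt (K + 1)) := by
    rw [Real.log_sqrt (by positivity)]
    ring
  have hs : Real.sqrt (2 * Real.pi * (K * noiseVar p ε i + noiseVar p ε i)) =
      Real.sqrt (K + 1) * Real.sqrt (2 * Real.pi * noiseVar p ε i) := by
    rw [← Real.sqrt_mul (by positivity)]
    congr 1
    ring
  rw [coordRatio, gaussianPDF, gaussianPDF, gaussianPDFReal, gaussianPDFReal,
    Real.coe_toNNReal _ hv.le, Real.coe_toNNReal _ (by positivity), hl,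
    Real.exp_log (by positivity), ← ENNReal.ofReal_mul (by positivity),
    ← ENNReal.ofReal_mul (by positivity), hs]
  congr 1
  have h1 : 0 < Real.sqrt (K + 1) := by positivity
  have h2 : 0 < Real.sqrt (2 * Real.pi * noiseVar p ε i) := by
    have := Real.pi_pos
    positivity
  simp only [sub_self, sub_zero, ne_eq, OfNat.ofNat_ne_zero, not_false_eq_true, zero_pow, neg_zero,
    zero_div, Real.exp_zero, neg_div]
  field_simp

/-- The two models give the same density to every coordinate outside `(I, N]`; `N ≤ n` ensures that
all differing coordinates are included. -/
theorem evidence_eq_evidenceRatio_mul {K α p ε : ℝ} (hK : 0 < K) (hε : 0 < ε)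
    {I N n : ℕ+} (hIN : I ≤ N) (hn : N ≤ n) (X : ℕ+ → ℝ) :
    evidence K α p ε n I X = evidenceRatio K α p ε I N X * evidence K α p ε n N X := by
  have hw : ENNReal.ofReal (priorWeight α I) =
      ENNReal.ofReal (Real.exp (α * ((N : ℝ) - I))) * ENNReal.ofReal (priorWeight α N) := by
    rw [← ENNReal.ofReal_mul (by positivity), priorWeight, priorWeight, mul_left_comm,
      ← Real.exp_add]
    congr 3
    ring
  have hsub : Finset.Ioc I N = (Finset.Icc 1 n).filter (· ∈ Finset.Ioc I N) := by
    ext i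
    simp only [Finset.mem_Ioc, Finset.mem_filter, Finset.mem_Icc]
    exact ⟨fun h => ⟨⟨one_le, h.2.trans hn⟩, h⟩, fun h => h.2⟩
  have hp : (∏ i ∈ Finset.Icc 1 n,
        gaussianPDF (truncate I X i) (priorVar K p ε I i + noiseVar p ε i).toNNReal (X i)) =
      (∏ i ∈ Finset.Ioc I N, coordRatio K p ε i (X i)) * ∏ i ∈ Finset.Icc 1 n,
        gaussianPDF (truncate N X i) (priorVar K p ε N i + noiseVar p ε i).toNNReal (X i) := by
    rw [hsub, Finset.prod_filter, ← Finset.prod_mul_distrib]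
    refine Finset.prod_congr rfl fun i _ => ?_
    by_cases h1 : i ≤ I
    · have h2 : i ≤ N := h1.trans hIN
      simp [h1, h2, truncate, priorVar, not_lt.2 h1]
    · by_cases h2 : i ≤ N
      · simp only [h1, h2, truncate, priorVar, not_le.1 h1, Finset.mem_Ioc, and_self, if_true,
          if_false, zero_add]
        exact (coordRatio_mul_gaussianPDF hK hε i (X i)).symm
      · simp [h1, h2, truncate, priorVar]
  rw [evidence, evidence, evidenceRatio, hw, hp]
  ring

/-- Keep only the term `N` of the normalizing sum; the bound is then free of `n` and passes to the
limit. -/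
theorem mixWeight_le_evidenceRatio {K α p ε : ℝ} (hK : 0 < K) (hα : 0 < α) (hε : 0 < ε)
    {I N : ℕ+} (hIN : I ≤ N) (X : ℕ+ → ℝ) :
    mixWeight K α p ε I X ≤ evidenceRatio K α p ε I N X := by
  refine le_of_tendsto (tendsto_mixWeightN hK hα hε I X) ?_
  filter_upwards [eventually_ge_atTop N] with n hn
  rw [mixWeightN, evidence_eq_evidenceRatio_mul hK hε hIN hn X]
  refine ENNReal.div_le_of_le_mul ?_
  gcongr
  exact ENNReal.le_tsum N

theorem tsum_mixWeight_le_one {K α p ε : ℝ} (hK : 0 < K) (hα : 0 < α) (hε : 0 < ε)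
    (X : ℕ+ → ℝ) : ∑' I, mixWeight K α p ε I X ≤ 1 := by
  rw [ENNReal.tsum_eq_iSup_sum]
  refine iSup_le fun F => ?_
  refine le_of_tendsto' (tendsto_finsetSum F fun I _ => tendsto_mixWeightN hK hα hε I X)
    fun n => ?_
  refine (ENNReal.sum_le_tsum F).trans ?_
  simp only [mixWeightN, div_eq_mul_inv, ENNReal.tsum_mul_right]
  exact ENNReal.div_self_le_one

instance isProbabilityMeasure_component (K p ε : ℝ) (I : ℕ+) (X : ℕ+ → ℝ) :
    IsProbabilityMeasure (component K p ε I X) := by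
  unfold component
  infer_instance

theorem ddm_apply (K α p ε : ℝ) (X : ℕ+ → ℝ) {B : Set (ℕ+ → ℝ)} (hB : MeasurableSet B) :
    ddm K α p ε X B = ∑' I, mixWeight K α p ε I X * component K p ε I X B := by
  rw [ddm, Measure.sum_apply _ hB]
  rfl

theorem ddm_le_one {K α p ε : ℝ} (hK : 0 < K) (hα : 0 < α) (hε : 0 < ε)
    (X : ℕ+ → ℝ) {B : Set (ℕ+ → ℝ)} (hB : MeasurableSet B) : ddm K α p ε X B ≤ 1 := by
  rw [ddm_apply K α p ε X hB]
  refine le_trans (ENNReal.tsum_le_tsum fun I => ?_) (tsum_mixWeight_le_one (p := p) hK hα hε X)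
  exact mul_le_of_le_one_right zero_le prob_le_one

instance isProbabilityMeasure_dataLaw (p ε : ℝ) (θ : ℕ+ → ℝ) :
    IsProbabilityMeasure (dataLaw p ε θ) := by
  unfold dataLaw
  infer_instance

theorem tsum_Ioi_eq_sum_Ioc_add {f : ℕ+ → ℝ} (hf : Summable f) {I N : ℕ+} (h : I ≤ N) :
    ∑' i : Set.Ioi I, f i = ∑ i ∈ Finset.Ioc I N, f i + ∑' i : Set.Ioi N, f i := by
  have hd : Disjoint (↑(Finset.Ioc I N) : Set ℕ+) (Set.Ioi N) := by
    rw [Finset.coe_Ioc, Set.disjoint_left]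
    exact fun i h1 h2 => absurd h1.2 (not_le.2 h2)
  rw [← Finset.tsum_subtype', ← Summable.tsum_union_disjoint hd (hf.subtype _) (hf.subtype _),
    Finset.coe_Ioc, Set.Ioc_union_Ioi_eq_Ioi h]

theorem one_le_kappaSq {p : ℝ} (hp : 0 ≤ p) (i : ℕ+) : 1 ≤ kappaSq p i :=
  Real.one_le_rpow (by exact_mod_cast i.pos) (by positivity)

theorem summable_sq_div_kappaSq {p : ℝ} (hp : 0 ≤ p) {θ : ℕ+ → ℝ} (hθ : θ ∈ ell2) :
    Summable fun i => θ i ^ 2 / kappaSq p i :=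
  Summable.of_nonneg_of_le
    (fun i => div_nonneg (sq_nonneg _) (zero_le_one.trans (one_le_kappaSq hp i)))
    (fun i => div_le_self (sq_nonneg _) (one_le_kappaSq hp i)) hθ

/-- Compare the surrogate criterion at `N` and at `I`: the tails beyond `N` cancel, and division by
`ε²` turns `κ_i²` into `σ_i²`. -/
theorem sub_le_sum_sq_div_noiseVar {p ε : ℝ} (hp : 0 ≤ p) (hε : 0 < ε) {θ : ℕ+ → ℝ}
    (hθ : θ ∈ ell2) {I N : ℕ+} (hN : IsSurrogateOracle p ε θ N) (hIN : I ≤ N) :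
    (N : ℝ) - I ≤ ∑ i ∈ Finset.Ioc I N, θ i ^ 2 / noiseVar p ε i := by
  have h := hN I
  rw [surrogateRateSq, surrogateRateSq,
    tsum_Ioi_eq_sum_Ioc_add (summable_sq_div_kappaSq hp hθ) hIN] at h
  have h2 : ∑ i ∈ Finset.Ioc I N, θ i ^ 2 / noiseVar p ε i =
      (∑ i ∈ Finset.Ioc I N, θ i ^ 2 / kappaSq p i) / ε ^ 2 := by
    rw [Finset.sum_div]
    refine Finset.sum_congr rfl fun i _ => ?_
    rw [noiseVar, div_div, mul_comm]
  rw [h2, le_div_iff₀ (by positivity)]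
  linarith

theorem lintegral_evidenceRatio_le {K α p ε : ℝ} (hK : 0 < K) (hp : 0 ≤ p) (hε : 0 < ε)
    {θ : ℕ+ → ℝ} (hθ : θ ∈ ell2) {I N : ℕ+} (hN : IsSurrogateOracle p ε θ N) (hIN : I ≤ N) :
    ∫⁻ X, evidenceRatio K α p ε I N X ∂(dataLaw p ε θ) ≤
      ENNReal.ofReal (Real.exp (-(aConst K - α) * ((N : ℝ) - I))) := by
  -- Origin of `a(K)`: the `1/4` per coordinate is compensated by `(1/4) ∑ θ_i²/σ_i² ≥ (N - I)/4`.
  have h1 : ∀ i : ℕ+, ∫⁻ x, coordRatio K p ε i x ∂(gaussianReal (θ i) (noiseVar p ε i).toNNReal) =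
      ENNReal.ofReal (Real.exp (1 / 4 - aConst K - 1 / 4 * (θ i ^ 2 / noiseVar p ε i))) := by
    intro i
    have hv := noiseVar_pos (p := p) hε i
    unfold coordRatio
    rw [lintegral_const_mul _ (by fun_prop), lintegral_gaussianReal_exp_neg_sq hv,
      ← ENNReal.ofReal_mul (by positivity), ← Real.exp_add, aConst,
      Real.log_div (by positivity) two_ne_zero]
    congr 2
    field_simp
    ring
  have hc : ((Finset.Ioc I N).card : ℝ) = (N : ℝ) - I := by
    rw [PNat.card_Ioc, Nat.cast_sub (by exact_mod_cast hIN)]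
  have hm : Measurable fun X : ℕ+ → ℝ => ∏ i ∈ Finset.Ioc I N, coordRatio K p ε i (X i) :=
    Finset.measurable_fun_prod _ fun i _ =>
      (measurable_coordRatio K p ε i).comp (measurable_pi_apply i)
  unfold evidenceRatio
  rw [lintegral_const_mul _ hm, dataLaw,
    lintegral_infinitePi_prod _ _ _ (measurable_coordRatio K p ε)]
  simp only [h1]
  rw [← ENNReal.ofReal_prod_of_nonneg fun i _ => (Real.exp_pos _).le, ← Real.exp_sum,
    ← ENNReal.ofReal_mul (by positivity), ← Real.exp_add]
  refine ENNReal.ofReal_le_ofReal (Real.exp_le_exp.2 ?_)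
  rw [Finset.sum_sub_distrib, Finset.sum_const, nsmul_eq_mul, hc, ← Finset.mul_sum]
  linarith [sub_le_sum_sq_div_noiseVar hp hε hθ hN hIN]

/-! ### Small balls under one component. -/

/-- Chernoff bound: on the ball, `1 ≤ exp (t (r² - ∑_{i ≤ J} (θ_i - c_i)²))`, and the integral
factorizes. `J ≤ I` keeps the variances used nondegenerate. -/
theorem component_l2Ball_le_exp_mul_prod {K p ε : ℝ} (hK : 0 < K) (hε : 0 < ε) {I J : ℕ+}
    (hJ : J ≤ I) (X c : ℕ+ → ℝ) {r t : ℝ} (hr : 0 ≤ r) (ht : 0 < t) :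
    component K p ε I X (l2Ball c r) ≤ ENNReal.ofReal (Real.exp (t * r ^ 2) *
      ∏ i ∈ Finset.Icc 1 J, (Real.sqrt (2 * t * (K / (K + 1) * noiseVar p ε i)))⁻¹) := by
  have hm : ∀ i : ℕ+, Measurable fun y : ℝ => ENNReal.ofReal (Real.exp (-t * (y - c i) ^ 2)) :=
    fun i => by fun_prop
  have hm' : Measurable fun θ : ℕ+ → ℝ =>
      ∏ i ∈ Finset.Icc 1 J, ENNReal.ofReal (Real.exp (-t * (θ i - c i) ^ 2)) :=
    Finset.measurable_fun_prod _ fun i _ => (hm i).comp (measurable_pi_apply i)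
  rw [← lintegral_indicator_one (measurableSet_l2Ball c r)]
  calc ∫⁻ θ, (l2Ball c r).indicator 1 θ ∂(component K p ε I X)
      ≤ ∫⁻ θ, ENNReal.ofReal (Real.exp (t * r ^ 2)) *
          ∏ i ∈ Finset.Icc 1 J, ENNReal.ofReal (Real.exp (-t * (θ i - c i) ^ 2))
            ∂(component K p ε I X) := by
        refine lintegral_mono fun θ => ?_
        by_cases h : θ ∈ l2Ball c r
        · rw [Set.indicator_of_mem h, Pi.one_apply,
            ← ENNReal.ofReal_prod_of_nonneg fun i _ => (Real.exp_pos _).le, ← Real.exp_sum,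
            ← ENNReal.ofReal_mul (by positivity), ← Real.exp_add, ENNReal.one_le_ofReal,
            Real.one_le_exp_iff, ← Finset.mul_sum]
          nlinarith [sum_sq_le_of_mem_l2Ball hr h (Finset.Icc 1 J)]
        · rw [Set.indicator_of_notMem h]
          exact zero_le
    _ = ENNReal.ofReal (Real.exp (t * r ^ 2)) * ∏ i ∈ Finset.Icc 1 J,
          ∫⁻ y, ENNReal.ofReal (Real.exp (-t * (y - c i) ^ 2))
            ∂(gaussianReal (truncate I X i)
              (if i ≤ I then K / (K + 1) * noiseVar p ε i else 0).toNNReal) := by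
        rw [lintegral_const_mul _ hm', component, lintegral_infinitePi_prod _ _ _ hm]
    _ ≤ ENNReal.ofReal (Real.exp (t * r ^ 2)) * ∏ i ∈ Finset.Icc 1 J,
          ENNReal.ofReal (Real.sqrt (2 * t * (K / (K + 1) * noiseVar p ε i)))⁻¹ := by
        gcongr with i hi
        rw [if_pos ((Finset.mem_Icc.1 hi).2.trans hJ)]
        have := noiseVar_pos (p := p) hε i
        exact lintegral_gaussianReal_exp_sub_sq_le (by positivity) ht _ _
    _ = _ := by
        rw [← ENNReal.ofReal_prod_of_nonneg fun i _ => by positivity,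
          ← ENNReal.ofReal_mul (by positivity)]

theorem component_l2Ball_le {K p ε : ℝ} (hK : 0 < K) (hp : 0 ≤ p) (hε : 0 < ε) {I J : ℕ+}
    (hJ : J ≤ I) (N : ℕ+) (X c : ℕ+ → ℝ) {δ : ℝ} (hδ : 0 < δ) :
    component K p ε I X (l2Ball c (δ * Real.sqrt (cumVar p ε N))) ≤
      ENNReal.ofReal ((δ * (Real.exp 1 * N / J) ^ (p + 1 / 2) /
        Real.sqrt (K / (K + 1))) ^ (J : ℕ)) := by
  have hN : (0 : ℝ) < N := by exact_mod_cast N.pos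
  have hJ0 : (0 : ℝ) < J := by exact_mod_cast J.pos
  set L := K / (K + 1) with hL
  have hL0 : 0 < L := by positivity
  set s := p + 1 / 2 with hs
  -- Since `Σ(N) ≤ ε² N^{2p+1}`, this `t` keeps the Chernoff factor below `e^{J/2}`, a constant per
  -- coordinate.
  set t : ℝ := J / (2 * (δ ^ 2 * ε ^ 2 * (N : ℝ) ^ (2 * p + 1))) with ht
  have ht0 : 0 < t := by positivity
  refine (component_l2Ball_le_exp_mul_prod hK hε hJ X c (by positivity) ht0).trans
    (ENNReal.ofReal_le_ofReal ?_)
  have h1 : t * (δ * Real.sqrt (cumVar p ε N)) ^ 2 ≤ J * (1 / 2) := by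
    rw [mul_pow, Real.sq_sqrt (cumVar_pos hε N).le, ht, div_mul_eq_mul_div,
      div_le_iff₀ (by positivity)]
    have := mul_le_mul_of_nonneg_left (cumVar_le (ε := ε) hp N)
      (show 0 ≤ (J : ℝ) * δ ^ 2 by positivity)
    linarith
  have h2 : ∀ i : ℕ+, Real.sqrt (2 * t * (L * noiseVar p ε i)) =
      Real.sqrt (J * L) / (δ * (N : ℝ) ^ s) * (i : ℝ) ^ p := by
    intro i
    have hi : (0 : ℝ) < i := by exact_mod_cast i.pos
    rw [← Real.sqrt_sq (show 0 ≤ Real.sqrt (J * L) / (δ * (N : ℝ) ^ s) * (i : ℝ) ^ p by positivity),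
      mul_pow, div_pow, Real.sq_sqrt (by positivity), mul_pow, ← Real.rpow_mul_natCast hN.le,
      ← Real.rpow_mul_natCast hi.le, ht, noiseVar, kappaSq]
    have e1 : s * ((2 : ℕ) : ℝ) = 2 * p + 1 := by push_cast; rw [hs]; ring
    have e2 : p * ((2 : ℕ) : ℝ) = 2 * p := by push_cast; ring
    rw [e1, e2]
    congr 1
    field_simp
  have h3 : ∏ i ∈ Finset.Icc 1 J, (Real.sqrt (2 * t * (L * noiseVar p ε i)))⁻¹ ≤
      (δ * (N : ℝ) ^ s / Real.sqrt (J * L)) ^ (J : ℕ) * (((J / Real.exp 1 : ℝ) ^ p)⁻¹) ^ (J : ℕ) := by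
    simp only [h2]
    rw [Finset.prod_inv_distrib, Finset.prod_mul_distrib, Finset.prod_const, PNat.card_Icc,
      Real.finsetProd_rpow _ _ fun i _ => by positivity, mul_inv, ← inv_pow, inv_div, inv_pow _ (J : ℕ),
      ← Real.rpow_mul_natCast (by positivity), mul_comm p, Real.rpow_natCast_mul (by positivity)]
    simp only [PNat.one_coe, Nat.add_sub_cancel]
    gcongr
    exact pow_div_exp_le_prod_Icc J
  calc _ ≤ Real.exp (1 / 2) ^ (J : ℕ) * ((δ * (N : ℝ) ^ s / Real.sqrt (J * L)) ^ (J : ℕ) *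
        (((J / Real.exp 1 : ℝ) ^ p)⁻¹) ^ (J : ℕ)) := by
        rw [← Real.exp_nat_mul]
        gcongr
    _ = _ := by
        rw [← mul_pow, ← mul_pow]
        congr 1
        rw [mul_div_right_comm (Real.exp 1), Real.mul_rpow (by positivity) hN.le,
          Real.sqrt_mul hJ0.le, ← Real.inv_rpow (by positivity), inv_div, hs,
          Real.rpow_add (show 0 < Real.exp 1 / J by positivity),
          Real.div_rpow (Real.exp_pos 1).le hJ0.le (1 / 2), ← Real.sqrt_eq_rpow (J : ℝ),
          ← Real.exp_mul, one_mul]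
        field_simp

/-! ### Calculus behind a constant uniform in `p`. -/

/-- The right side is at least `exp (s log s - x s)`, whose minimum over `s` is at `s = e^{x-1}`.
This settles the range where `log (1/δ)` is comparable to `s`. -/
theorem exp_neg_exp_le_rpow {s x d : ℝ} (hs : 0 < s) (hd : s ≤ Real.log (1 / d)) (hd0 : 0 < d)
    (hx : Real.log (1 / d) ≤ x * s) :
    Real.exp (-Real.exp (x - 1)) ≤ d * Real.log (1 / d) ^ s := by
  have h1 : Real.exp (-(x * s)) ≤ d := by
    rw [← Real.exp_log hd0, Real.exp_le_exp]
    rw [one_div, Real.log_inv] at hx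
    linarith
  have h2 : Real.exp (s * Real.log s) ≤ Real.log (1 / d) ^ s := by
    rw [mul_comm, ← Real.rpow_def_of_pos hs]
    gcongr
  refine le_trans ?_ (mul_le_mul h1 h2 (by positivity) hd0.le)
  rw [← Real.exp_add, Real.exp_le_exp]
  have h3 := Real.add_one_le_exp (x - 1 - Real.log s)
  rw [Real.exp_sub _ (Real.log s), Real.exp_log hs, le_div_iff₀ hs] at h3
  linarith

/-- Apply `u ≤ e^u` with `u = b n / (4 s)` and raise to the power `s`. -/
theorem exp_neg_mul_rpow_le {b s n l : ℝ} (hb : 0 < b) (hs : 0 < s) (hn : 0 ≤ n)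
    (hl : 4 * Real.exp 1 / b * s ≤ l) :
    Real.exp (-(b * n / 4)) * (Real.exp 1 * n) ^ s ≤ l ^ s := by
  have h1 : (b * n / 4 / s) ^ s ≤ Real.exp (b * n / 4) := by
    calc (b * n / 4 / s) ^ s ≤ Real.exp (b * n / 4 / s) ^ s := by
          gcongr
          linarith [Real.add_one_le_exp (b * n / 4 / s)]
      _ = Real.exp (b * n / 4) := by
          rw [← Real.exp_mul]
          congr 1
          field_simp
  have h2 : (Real.exp 1 * n) ^ s = (4 * Real.exp 1 / b * s) ^ s * (b * n / 4 / s) ^ s := by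
    rw [← Real.mul_rpow (by positivity) (by positivity)]
    congr 1
    field_simp
  have hl0 : 0 ≤ l := le_trans (by positivity) hl
  rw [h2, mul_comm, mul_assoc]
  calc _ ≤ l ^ s * (Real.exp (b * n / 4) * Real.exp (-(b * n / 4))) := by gcongr
    _ = l ^ s := by rw [← Real.exp_add]; simp

/-- The square root is at most `√(2s) ≤ e^s`, and the base of the power is at most `1/(4e) ≤
e^{-2}`. -/
theorem deltaSB_le {K α p : ℝ} (hK : 0 < K) (hα : 0 < α) (hαK : α < aConst K) (hp : 0 ≤ p) :
    deltaSB K α p ≤ Real.exp (-(p + 1 / 2)) := by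
  set s := p + 1 / 2 with hs
  have hs0 : 0 < s := by positivity
  have ha : 0 < aConst K := hα.trans hαK
  have h1 : Real.sqrt (K * (2 * p + 1) / (K + 1)) ≤ Real.exp s := by
    rw [Real.sqrt_le_left (by positivity), ← Real.exp_nat_mul]
    calc K * (2 * p + 1) / (K + 1) ≤ 2 * p + 1 := by
          rw [div_le_iff₀ (by positivity)]
          nlinarith
      _ ≤ Real.exp (((2 : ℕ) : ℝ) * s) := by
          have := Real.add_one_le_exp (((2 : ℕ) : ℝ) * s)
          push_cast at this ⊢
          linarith
  have h2 : ((aConst K - α) / (4 * Real.exp 1 * aConst K)) ^ s ≤ Real.exp (-2) ^ s := by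
    refine Real.rpow_le_rpow (div_nonneg (by linarith) (by positivity)) ?_ hs0.le
    have h4 : Real.exp 1 ≤ 4 := by linarith [Real.exp_one_lt_d9]
    have h5 : Real.exp (-2) * (Real.exp 1 * Real.exp 1) = 1 := by
      rw [← Real.exp_add, ← Real.exp_add]
      norm_num
    have h6 : 1 ≤ Real.exp (-2) * (4 * Real.exp 1) := by
      refine h5.symm.le.trans ?_
      gcongr
    rw [div_le_iff₀ (by positivity)]
    nlinarith
  calc deltaSB K α p ≤ _ := min_le_right _ _
    _ ≤ Real.exp s * Real.exp (-2) ^ s := by gcongr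
    _ = Real.exp (-s) := by
        rw [← Real.exp_mul, ← Real.exp_add]
        congr 1
        ring

theorem le_log_one_div {K α p δ : ℝ} (hK : 0 < K) (hα : 0 < α) (hαK : α < aConst K) (hp : 0 ≤ p)
    (hδ : 0 < δ) (h : δ ≤ deltaSB K α p) : p + 1 / 2 ≤ Real.log (1 / δ) := by
  rw [one_div δ, Real.log_inv, le_neg, Real.log_le_iff_le_exp hδ]
  exact h.trans (deltaSB_le hK hα hαK hp)

/-! ### Assembling the small ball bound. -/

theorem summable_exp_neg_mul_pnat {c : ℝ} (hc : 0 < c) :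
    Summable fun I : ℕ+ => Real.exp (-(c * (I : ℝ))) := by
  have h := (Real.summable_exp_nat_mul_iff.2 (neg_lt_zero.2 hc)).comp_injective
    PNat.coe_injective
  refine h.congr fun I => ?_
  simp only [Function.comp_apply]
  congr 1
  ring

theorem ddm_l2Ball_le {K α p ε : ℝ} (hK : 0 < K) (hα : 0 < α) (hp : 0 ≤ p) (hε : 0 < ε)
    (N : ℕ+) (X c : ℕ+ → ℝ) {δ : ℝ} (hδ : 0 < δ) :
    ddm K α p ε X (l2Ball c (δ * Real.sqrt (cumVar p ε N))) ≤
      (∑' I : ℕ+, if 2 * I < N then evidenceRatio K α p ε I N X * ENNReal.ofReal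
        (δ * (Real.exp 1 * N) ^ (p + 1 / 2) / Real.sqrt (K / (K + 1))) else 0) +
      ENNReal.ofReal (δ * (2 * Real.exp 1) ^ (p + 1 / 2) / Real.sqrt (K / (K + 1))) := by
  set y := δ * (2 * Real.exp 1) ^ (p + 1 / 2) / Real.sqrt (K / (K + 1)) with hy
  have hN : (0 : ℝ) < N := by exact_mod_cast N.pos
  rw [ddm_apply K α p ε X (measurableSet_l2Ball _ _)]
  calc _ ≤ ∑' I : ℕ+, ((if 2 * I < N then evidenceRatio K α p ε I N X * ENNReal.ofReal
          (δ * (Real.exp 1 * N) ^ (p + 1 / 2) / Real.sqrt (K / (K + 1))) else 0) +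
          mixWeight K α p ε I X * ENNReal.ofReal y) := by
        refine ENNReal.tsum_le_tsum fun I => ?_
        split_ifs with h
        · refine le_add_right (mul_le_mul' (mixWeight_le_evidenceRatio hK hα hε ?_ X) ?_)
          · rw [← PNat.coe_lt_coe, PNat.mul_coe] at h
            rw [← PNat.coe_le_coe]
            change 2 * (I : ℕ) < N at h
            omega
          · simpa using component_l2Ball_le hK hp hε (one_le : 1 ≤ I) N X c hδ
        · rw [zero_add]
          gcongr
          have h1 := component_l2Ball_le hK hp hε (min_le_left I N) N X c hδ
          have hJ : (0 : ℝ) < (min I N : ℕ+) := by exact_mod_cast (min I N).pos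
          have h2 : (N : ℝ) ≤ 2 * (min I N : ℕ+) := by
            rw [← PNat.coe_lt_coe, PNat.mul_coe] at h
            change ¬ 2 * (I : ℕ) < N at h
            rcases min_choice I N with h' | h' <;> rw [h']
            · exact_mod_cast not_lt.1 h
            · linarith
          have h3 : δ * (Real.exp 1 * N / (min I N : ℕ+)) ^ (p + 1 / 2) /
              Real.sqrt (K / (K + 1)) ≤ y := by
            rw [hy]
            gcongr
            rw [div_le_iff₀ hJ]
            nlinarith [Real.exp_pos 1]
          -- If `y ≤ 1`, the power `J ≥ 1` only helps; if `y ≥ 1`, the claim is weaker than mass at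
          -- most one.
          rcases le_total y 1 with hy1 | hy1
          · refine h1.trans (ENNReal.ofReal_le_ofReal ?_)
            exact (pow_le_of_le_one (by positivity) (h3.trans hy1) (min I N).ne_zero).trans h3
          · exact prob_le_one.trans (ENNReal.one_le_ofReal.2 hy1)
    _ ≤ _ := by
        rw [ENNReal.tsum_add, ENNReal.tsum_mul_right]
        gcongr
        exact mul_le_of_le_one_left zero_le (tsum_mixWeight_le_one hK hα hε X)

theorem expBallMass_le_one {K α p ε : ℝ} (hK : 0 < K) (hα : 0 < α) (hε : 0 < ε)
    (θhat : (ℕ+ → ℝ) → (ℕ+ → ℝ)) (θ : ℕ+ → ℝ) (r : ℝ) : expBallMass K α p ε θhat θ r ≤ 1 := by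
  refine (lintegral_mono fun X => ddm_le_one hK hα hε X (measurableSet_l2Ball _ _)).trans ?_
  simp

theorem expBallMass_mono (K α p ε : ℝ) (θhat : (ℕ+ → ℝ) → (ℕ+ → ℝ)) (θ : ℕ+ → ℝ) {r s : ℝ}
    (h : r ≤ s) : expBallMass K α p ε θhat θ r ≤ expBallMass K α p ε θhat θ s :=
  lintegral_mono fun _ => measure_mono (l2Ball_mono _ h)

theorem lintegral_evidenceRatio_mul_le {K α p ε : ℝ} (hK : 0 < K) (hαK : α < aConst K)
    (hp : 0 ≤ p) (hε : 0 < ε) {θ : ℕ+ → ℝ} (hθ : θ ∈ ell2) {I N : ℕ+}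
    (hN : IsSurrogateOracle p ε θ N) (hIN : 2 * I < N) {y l : ℝ} (hy : 0 ≤ y)
    (hl : 4 * Real.exp 1 / (aConst K - α) * (p + 1 / 2) ≤ l) :
    ∫⁻ X, evidenceRatio K α p ε I N X *
        ENNReal.ofReal (y * (Real.exp 1 * N) ^ (p + 1 / 2)) ∂(dataLaw p ε θ) ≤
      ENNReal.ofReal (y * l ^ (p + 1 / 2)) *
        ENNReal.ofReal (Real.exp (-((aConst K - α) / 2 * (I : ℝ)))) := by
  set b := aConst K - α with hb
  have hb0 : 0 < b := sub_pos.2 hαK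
  have h2 : 2 * (I : ℝ) < N := by
    rw [← PNat.coe_lt_coe, PNat.mul_coe] at hIN
    exact_mod_cast hIN
  have hI : (0 : ℝ) < I := by exact_mod_cast I.pos
  have hN0 : (0 : ℝ) < N := by linarith
  have hIN' : I ≤ N := by
    have : (I : ℝ) ≤ N := by linarith
    exact_mod_cast this
  have hl0 : 0 ≤ l := le_trans (by positivity) hl
  rw [lintegral_mul_const _ (measurable_evidenceRatio K α p ε I N)]
  refine (mul_le_mul_left (lintegral_evidenceRatio_le hK hp hε hθ hN hIN') _).trans ?_
  rw [← ENNReal.ofReal_mul (by positivity), ← ENNReal.ofReal_mul (by positivity)]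
  refine ENNReal.ofReal_le_ofReal ?_
  -- `2 * I < N` gives `N - I ≥ I/2 + N/4`: one part makes the sum over `I` converge, the other
  -- absorbs `N^s`.
  have h3 : Real.exp (-b * ((N : ℝ) - I)) ≤
      Real.exp (-(b / 2 * I)) * Real.exp (-(b * N / 4)) := by
    rw [← Real.exp_add, Real.exp_le_exp]
    nlinarith
  calc _ ≤ Real.exp (-(b / 2 * I)) * Real.exp (-(b * N / 4)) *
        (y * (Real.exp 1 * N) ^ (p + 1 / 2)) := by gcongr
    _ = y * (Real.exp (-(b * N / 4)) * (Real.exp 1 * N) ^ (p + 1 / 2)) *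
        Real.exp (-(b / 2 * I)) := by ring
    _ ≤ _ := by
        gcongr
        exact exp_neg_mul_rpow_le hb0 (by positivity) hN0.le hl

theorem exists_expBallMass_le (K α : ℝ) (hK : 0 < K) (hα : 0 < α) (hαK : α < aConst K) :
    ∃ C : ℝ, 0 < C ∧ ∀ p : ℝ, 0 ≤ p → ∀ ε : ℝ, 0 < ε →
      ∀ θhat : (ℕ+ → ℝ) → (ℕ+ → ℝ), ∀ θ₀ ∈ ell2, ∀ I : ℕ+, IsSurrogateOracle p ε θ₀ I →
        ∀ δ : ℝ, 0 < δ → δ ≤ deltaSB K α p →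
          expBallMass K α p ε θhat θ₀ (δ * Real.sqrt (cumVar p ε I)) ≤
            ENNReal.ofReal (C * δ * Real.log (1 / δ) ^ (p + 1 / 2)) := by
  have hb0 : 0 < aConst K - α := sub_pos.2 hαK
  set b := aConst K - α with hb
  -- When `l ≥ x s`, the first summand permits `exp_neg_mul_rpow_le`; the second gives `l ≥ 2e`,
  -- because `s ≥ 1/2`.
  set x := 4 * Real.exp 1 / b + 4 * Real.exp 1 with hx
  set R := Real.sqrt (K / (K + 1)) with hR
  have hR0 : 0 < R := by positivity
  have hsum := summable_exp_neg_mul_pnat (half_pos hb0)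
  set Q := ∑' I : ℕ+, Real.exp (-(b / 2 * (I : ℝ))) with hQ
  have hQ0 : 0 ≤ Q := tsum_nonneg fun I => (Real.exp_pos _).le
  refine ⟨Real.exp (Real.exp (x - 1)) + (Q + 1) / R, by positivity, ?_⟩
  intro p hp ε hε θhat θ hθ N hN δ hδ hδ'
  have hs0 : 0 < p + 1 / 2 := by positivity
  have hsl := le_log_one_div hK hα hαK hp hδ hδ'
  set l := Real.log (1 / δ) with hl
  have hl0 : 0 < l := hs0.trans_le hsl
  have hly : 0 ≤ δ * l ^ (p + 1 / 2) := by positivity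
  rcases le_total l (x * (p + 1 / 2)) with h | h
  · refine (expBallMass_le_one hK hα hε θhat θ _).trans (ENNReal.one_le_ofReal.2 ?_)
    have h1 := exp_neg_exp_le_rpow hs0 hsl hδ h
    calc (1 : ℝ) = Real.exp (Real.exp (x - 1)) * Real.exp (-Real.exp (x - 1)) := by
          rw [← Real.exp_add]; simp
      _ ≤ Real.exp (Real.exp (x - 1)) * (δ * l ^ (p + 1 / 2)) := by gcongr
      _ ≤ (Real.exp (Real.exp (x - 1)) + (Q + 1) / R) * (δ * l ^ (p + 1 / 2)) := by
          refine mul_le_mul_of_nonneg_right ?_ hly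
          exact le_add_of_nonneg_right (by positivity)
      _ = _ := by ring
  · have hl1 : 4 * Real.exp 1 / b * (p + 1 / 2) ≤ l := by
      refine le_trans ?_ h
      gcongr
      exact le_add_of_nonneg_right (by positivity)
    have hl2 : 2 * Real.exp 1 ≤ l := by
      refine le_trans ?_ h
      have h1 : 4 * Real.exp 1 ≤ x := le_add_of_nonneg_left (by positivity)
      nlinarith [Real.exp_pos 1]
    have hmeas : ∀ I : ℕ+, Measurable fun X => if 2 * I < N then evidenceRatio K α p ε I N X *
        ENNReal.ofReal (δ / R * (Real.exp 1 * N) ^ (p + 1 / 2)) else 0 := by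
      intro I
      split_ifs
      · exact (measurable_evidenceRatio K α p ε I N).mul_const _
      · exact measurable_const
    calc expBallMass K α p ε θhat θ (δ * Real.sqrt (cumVar p ε N))
        ≤ ∫⁻ X, ((∑' I : ℕ+, if 2 * I < N then evidenceRatio K α p ε I N X *
            ENNReal.ofReal (δ / R * (Real.exp 1 * N) ^ (p + 1 / 2)) else 0) +
            ENNReal.ofReal (δ / R * (2 * Real.exp 1) ^ (p + 1 / 2))) ∂(dataLaw p ε θ) := by
          refine lintegral_mono fun X => ?_
          simp only [div_mul_eq_mul_div]
          exact ddm_l2Ball_le hK hα hp hε N X (θhat X) hδ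
      _ = (∑' I : ℕ+, ∫⁻ X, (if 2 * I < N then evidenceRatio K α p ε I N X *
            ENNReal.ofReal (δ / R * (Real.exp 1 * N) ^ (p + 1 / 2)) else 0) ∂(dataLaw p ε θ)) +
            ENNReal.ofReal (δ / R * (2 * Real.exp 1) ^ (p + 1 / 2)) := by
          rw [lintegral_add_right _ measurable_const,
            lintegral_tsum fun I => (hmeas I).aemeasurable]
          simp
      _ ≤ (∑' I : ℕ+, ENNReal.ofReal (δ / R * l ^ (p + 1 / 2)) *
            ENNReal.ofReal (Real.exp (-(b / 2 * (I : ℝ))))) +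
            ENNReal.ofReal (δ / R * l ^ (p + 1 / 2)) := by
          refine add_le_add (ENNReal.tsum_le_tsum fun I => ?_) ?_
          · split_ifs with hI
            · exact lintegral_evidenceRatio_mul_le hK hαK hp hε hθ hN hI (by positivity) hl1
            · simp
          · gcongr
      _ = ENNReal.ofReal ((Q + 1) / R * (δ * l ^ (p + 1 / 2))) := by
          rw [ENNReal.tsum_mul_left, ← ENNReal.ofReal_tsum_of_nonneg
            (fun I => (Real.exp_pos _).le) hsum, ← ENNReal.ofReal_mul (by positivity),
            ← ENNReal.ofReal_add (by positivity) (by positivity)]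
          congr 1
          ring
      _ ≤ _ := by
          rw [mul_assoc _ δ]
          refine ENNReal.ofReal_le_ofReal (mul_le_mul_of_nonneg_right ?_ hly)
          exact le_add_of_nonneg_left (by positivity)

/-! ### Transfer to the oracle rate under the bias restriction. -/

theorem oracleRate_le {p ε τ : ℝ} (hε : 0 < ε) (hτ : 0 < τ) {θ : ℕ+ → ℝ} {I : ℕ+}
    (h : ∑' i : Set.Ioi I, θ i ^ 2 ≤ τ * cumVar p ε I) :
    oracleRate p ε θ ≤ Real.sqrt (1 + τ) * Real.sqrt (cumVar p ε I) := by
  rw [← Real.sqrt_mul (by positivity)]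
  refine Real.sqrt_le_sqrt ((ciInf_le ⟨0, ?_⟩ I).trans ?_)
  · rintro _ ⟨J, rfl⟩
    exact add_nonneg (cumVar_pos hε J).le (tsum_nonneg fun i => sq_nonneg _)
  · rw [localRateSq]
    linarith

end InverseNoise

open InverseNoise

theorem corollary3p1 (K α : ℝ) (hK : 0 < K) (hα : 0 < α) (hαK : α < aConst K) :
    ∃ Csb : ℝ, 0 < Csb ∧
      ∀ p : ℝ, 0 ≤ p → ∀ ε : ℝ, 0 < ε →
      ∀ θhat : (ℕ+ → ℝ) → (ℕ+ → ℝ), Measurable θhat →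
        (∀ θ₀ ∈ ell2, ∀ I : ℕ+, IsSurrogateOracle p ε θ₀ I →
          ∀ δ : ℝ, 0 < δ → δ ≤ deltaSB K α p →
            expBallMass K α p ε θhat θ₀ (δ * Real.sqrt (cumVar p ε I)) ≤
              ENNReal.ofReal (Csb * δ * Real.log (1 / δ) ^ (p + 1 / 2))) ∧
        (∀ τ : ℝ, 0 < τ → ∀ δ : ℝ, 0 < δ → δ ≤ deltaEB K α p τ →
          ⨆ θ₀ ∈ excessBiasSet p ε τ,
              expBallMass K α p ε θhat θ₀ (δ * oracleRate p ε θ₀) ≤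
            ENNReal.ofReal
              (Csb * Real.sqrt (1 + τ) * δ * Real.log (1 / δ) ^ (p + 1 / 2))) := by
  obtain ⟨C, hC, hmain⟩ := exists_expBallMass_le K α hK hα hαK
  refine ⟨C, hC, fun p hp ε hε θhat _ => ⟨hmain p hp ε hε θhat, fun τ hτ δ hδ hδ' => ?_⟩⟩
  refine iSup₂_le fun θ hθ => ?_
  obtain ⟨hθ2, I, hI, hbias⟩ := hθ
  have hr : 0 < Real.sqrt (1 + τ) := by positivity
  have hr1 : 1 ≤ Real.sqrt (1 + τ) := Real.one_le_sqrt.2 (by linarith)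
  have hδ2 : Real.sqrt (1 + τ) * δ ≤ deltaSB K α p := by
    rw [deltaEB, Real.rpow_neg (by positivity), ← Real.sqrt_eq_rpow, inv_mul_eq_div,
      le_div_iff₀ hr] at hδ'
    linarith
  have hlog : 0 ≤ Real.log (1 / (Real.sqrt (1 + τ) * δ)) :=
    le_trans (by positivity) (le_log_one_div hK hα hαK hp (mul_pos hr hδ) hδ2)
  calc expBallMass K α p ε θhat θ (δ * oracleRate p ε θ)
      ≤ expBallMass K α p ε θhat θ (Real.sqrt (1 + τ) * δ * Real.sqrt (cumVar p ε I)) := by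
        refine expBallMass_mono K α p ε θhat θ ?_
        have := mul_le_mul_of_nonneg_left (oracleRate_le hε hτ hbias) hδ.le
        linarith
    _ ≤ _ := hmain p hp ε hε θhat θ hθ2 I hI _ (mul_pos hr hδ) hδ2
    -- Replacing `√(1+τ) δ` by the smaller `δ` inside the logarithm increases it; `hlog` makes the
    -- power monotone.
    _ ≤ _ := by
        rw [← mul_assoc C]
        gcongr
        exact le_mul_of_one_le_left hδ.le hr1
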